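/- Let $\mathscr H$ be a complex Hilbert space, let $C_1,\dots,C_n$ be arbitrary bounded operators on $\mathscr H$, and let $B,A_1,\dots,A_n$ be bounded self-adjoint operators on $\mathscr H$ such that $B-\sum_{i=1}^n C_i^*A_iC_i>0$ and $A_i>0$ for all $1\le i\le n$, where $X>0$ means that $X$ is positive and invertible. Put $D=\left(I+\sum_{i=1}^n C_i^*C_i\right)^{-1/2}$. Then $D>0$, $DBD>0$, and, with powers and logarithms taken in the continuous functional calculus and $\le$ denoting the usual (Loewner) order on self-adjoint operators, \begin{align*} &\text{(i)}\quad \Big(B-\sum_{i=1}^n C_i^*A_iC_i\Big)^{-1}+\sum_{i=1}^n C_i^*A_i^{-1}C_i\ \ge\ D^{-1}(DBD)^{-1}D^{-1};\\ &\text{(ii)}\quad \Big(B-\sum_{i=1}^n C_i^*A_iC_i\Big)^{p}+\sum_{i=1}^n C_i^*A_i^{p}C_i\ \ge\ D^{-1}(DBD)^{p}D^{-1}\quad\text{for every } p\in[-1,0]\cup[1,2];\\ &\text{(iii)}\quad \Big(B-\sum_{i=1}^n C_i^*A_iC_i\Big)^{p}+\sum_{i=1}^n C_i^*A_i^{p}C_i\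 \le\ D^{-1}(DBD)^{p}D^{-1}\quad\text{for every } p\in[0,1];\\ &\text{(iv)}\quad \log\Big(B-\sum_{i=1}^n C_i^*A_iC_i\Big)+\sum_{i=1}^n C_i^*\log(A_i)\,C_i\ \le\ D^{-1}\log(DBD)\,D^{-1}. \end{align*} -/

import Mathlib

/-- The operator `D = (I + ∑ Cᵢ* Cᵢ)^{-1/2}` attached to bounded operators `C₁, …, Cₙ` on a
Hilbert space; the power is taken in the continuous functional calculus. -/
noncomputable def huaD {H : Type*} [NormedAddCommGroup H] [InnerProductSpace ℂ H]
    [CompleteSpace H] {n : ℕ} (C : Fin n → (H →L[ℂ] H)) : H →L[ℂ] H :=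
  (1 + ∑ i, star (C i) * C i) ^ (-(1 / 2) : ℝ)

/-! ### Operator Jensen inequalities for families with `∑ i, star (K i) * K i = 1`. -/

section OperatorJensen

open Set MeasureTheory Filter Topology

variable {A : Type*} [CStarAlgebra A] [PartialOrder A] [StarOrderedRing A]
  {ι : Type*} [Fintype ι] {X K : ι → A}

/-! The family `D, C₁D, …, CₙD` satisfies `∑ K* K = D (I + ∑ Cᵢ* Cᵢ) D = I`, and it sends the tuple
`(B - ∑ Cᵢ* Aᵢ Cᵢ, A₁, …, Aₙ)` to `∑ K* Y K = DBD`. Each claim is therefore an operator Jensen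
inequality comparing `f(∑ K* Y K)` with `∑ K* f(Y) K`, conjugated by `D⁻¹`.

Completing a square gives Jensen for the inverse (`ringInverse_sum_star_conjugate_le`). Shifting by
`t > 0` and integrating over `t` gives the powers in `(0,1)` and `(1,2)`. Antitonicity of the
inverse then handles `[-1,0)`, and a limit `p → 0⁺` the logarithm. -/

lemma sum_star_conjugate_nonneg (hX : ∀ i, 0 ≤ X i) : 0 ≤ ∑ i, star (K i) * X i * K i :=
  Finset.sum_nonneg fun i _ => star_left_conjugate_nonneg (hX i) (K i)

omit [PartialOrder A] [StarOrderedRing A] in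
lemma sum_star_conjugate_algebraMap (hK : ∑ i, star (K i) * K i = 1) (r : ℝ) :
    ∑ i, star (K i) * algebraMap ℝ A r * K i = algebraMap ℝ A r := by
  simp_rw [Algebra.algebraMap_eq_smul_one, mul_smul_comm, smul_mul_assoc, mul_one,
    ← Finset.smul_sum, hK]

/-- The operator Jensen inequality for the inverse. -/
lemma ringInverse_sum_star_conjugate_le (hK : ∑ i, star (K i) * K i = 1)
    (hX : ∀ i, IsStrictlyPositive (X i))
    (hM : IsStrictlyPositive (∑ i, star (K i) * X i * K i)) :
    Ring.inverse (∑ i, star (K i) * X i * K i) ≤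
      ∑ i, star (K i) * Ring.inverse (X i) * K i := by
  set M := ∑ i, star (K i) * X i * K i with hMdef
  set N := Ring.inverse M
  have hNs : star N = N := hM.isSelfAdjoint.ringInverse.star_eq
  have hMN : M * N = 1 := Ring.mul_inverse_cancel M hM.isUnit
  -- Square weighted by `(X i)⁻¹`; summed over `i`, these nonnegative terms equal the gap between
  -- the two sides.
  have key : ∀ i, star (X i * K i * N - K i) * Ring.inverse (X i) * (X i * K i * N - K i) =
      N * (star (K i) * X i * K i) * N - N * (star (K i) * K i) - star (K i) * K i * N
        + star (K i) * Ring.inverse (X i) * K i := by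
    intro i
    have h1 : X i * Ring.inverse (X i) = 1 := Ring.mul_inverse_cancel _ (hX i).isUnit
    have h2 : Ring.inverse (X i) * X i = 1 := Ring.inverse_mul_cancel _ (hX i).isUnit
    have h3 : ∀ z, X i * (Ring.inverse (X i) * z) = z := fun z => by
      rw [← mul_assoc, h1, one_mul]
    have h4 : ∀ z, Ring.inverse (X i) * (X i * z) = z := fun z => by
      rw [← mul_assoc, h2, one_mul]
    simp only [star_sub, star_mul, hNs, (hX i).isSelfAdjoint.star_eq, sub_mul, mul_sub, mul_assoc,
      h3, h4]
    abel
  have hsum : ∑ i, star (X i * K i * N - K i) * Ring.inverse (X i) * (X i * K i * N - K i) =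
      ∑ i, star (K i) * Ring.inverse (X i) * K i - N := by
    simp_rw [key, Finset.sum_add_distrib, Finset.sum_sub_distrib, ← Finset.sum_mul,
      ← Finset.mul_sum, hK, ← hMdef]
    rw [mul_assoc, hMN]
    simp only [mul_one, one_mul]
    abel
  rw [← sub_nonneg, ← hsum]
  exact sum_star_conjugate_nonneg fun i => (hX i).ringInverse.nonneg

lemma ringInverse_algebraMap_add_sum_star_conjugate_le (hK : ∑ i, star (K i) * K i = 1)
    (hX : ∀ i, 0 ≤ X i) {t : ℝ} (ht : 0 < t) :
    Ring.inverse (algebraMap ℝ A t + ∑ i, star (K i) * X i * K i) ≤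
      ∑ i, star (K i) * Ring.inverse (algebraMap ℝ A t + X i) * K i := by
  have hpos : ∀ a : A, 0 ≤ a → IsStrictlyPositive (algebraMap ℝ A t + a) := fun a ha =>
    (isStrictlyPositive_algebraMap ht).of_le (le_add_of_nonneg_right ha)
  have hsum : algebraMap ℝ A t + ∑ i, star (K i) * X i * K i =
      ∑ i, star (K i) * (algebraMap ℝ A t + X i) * K i := by
    simp_rw [mul_add, add_mul, Finset.sum_add_distrib, sum_star_conjugate_algebraMap hK]
  have hM := hpos _ (sum_star_conjugate_nonneg (K := K) hX)
  rw [hsum] at hM ⊢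
  exact ringInverse_sum_star_conjugate_le hK (fun i => hpos _ (hX i)) hM

lemma cfc_inv_const_add {a : A} (ha : 0 ≤ a) {t : ℝ} (ht : 0 < t) :
    cfc (fun x : ℝ => (t + x)⁻¹) a = Ring.inverse (algebraMap ℝ A t + a) := by
  have hspec : ∀ r ∈ spectrum ℝ a, t + r ≠ 0 := fun r hr =>
    (add_pos_of_pos_of_nonneg ht (spectrum_nonneg_of_nonneg ha hr)).ne'
  rw [cfc_inv _ _ hspec .., cfc_const_add .., cfc_id' ..]

/-- The resolvent enters with a negative coefficient, which reverses Jensen for the powers in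
`(0,1)`. -/
lemma cfcₙ_rpowIntegrand₀₁_eq {a : A} (ha : 0 ≤ a) {p t : ℝ} (hp : p ∈ Ioo 0 1) (ht : 0 < t) :
    cfcₙ (Real.rpowIntegrand₀₁ p t) a =
      algebraMap ℝ A (t ^ (p - 1)) - t ^ p • Ring.inverse (algebraMap ℝ A t + a) := by
  have hspec : ∀ r ∈ spectrum ℝ a, t + r ≠ 0 := fun r hr =>
    (add_pos_of_pos_of_nonneg ht (spectrum_nonneg_of_nonneg ha hr)).ne'
  have hcont : ContinuousOn (fun z : ℝ => (t + z)⁻¹) (spectrum ℝ a) := by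
    fun_prop (disch := assumption)
  have hqs : quasispectrum ℝ a ⊆ Ici 0 := fun r hr => quasispectrum_nonneg_of_nonneg a ha r hr
  rw [cfcₙ_eq_cfc ((Real.continuousOn_rpowIntegrand₀₁_Ici hp ht).mono hqs)
      Real.rpowIntegrand₀₁_zero_right, Real.rpowIntegrand₀₁_eq_sub hp.2.ne ht,
    cfc_sub (fun _ : ℝ => t ^ (p - 1)) (fun z : ℝ => t ^ p * (t + z)⁻¹) a continuousOn_const
      (continuousOn_const.mul hcont),
    cfc_const _ a ha.isSelfAdjoint, cfc_const_mul _ _ a hcont, cfc_inv_const_add ha ht]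

/-- The resolvent coefficient is now positive, and the remaining affine part satisfies Jensen with
equality. -/
lemma cfcₙ_rpowIntegrand₁₂_eq {a : A} (ha : 0 ≤ a) {p t : ℝ} (hp : p ∈ Ioo 1 2) (ht : 0 < t) :
    cfcₙ (Real.rpowIntegrand₁₂ p t) a =
      t ^ (p - 1) • (t⁻¹ • a + t • Ring.inverse (algebraMap ℝ A t + a) - 1) := by
  have hspec : ∀ r ∈ spectrum ℝ a, t + r ≠ 0 := fun r hr =>
    (add_pos_of_pos_of_nonneg ht (spectrum_nonneg_of_nonneg ha hr)).ne'
  have hcont : ContinuousOn (fun z : ℝ => (t + z)⁻¹) (spectrum ℝ a) := by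
    fun_prop (disch := assumption)
  have hqs : quasispectrum ℝ a ⊆ Ici 0 := fun r hr => quasispectrum_nonneg_of_nonneg a ha r hr
  have hcont' : ContinuousOn (Real.rpowIntegrand₁₂ p t) (quasispectrum ℝ a) :=
    (Real.continuousOn_rpowIntegrand₁₂_uncurry hp.1 _ hqs).uncurry_left _ ht
  rw [cfcₙ_eq_cfc hcont' (Real.rpowIntegrand₁₂_zero ht)]
  unfold Real.rpowIntegrand₁₂
  have h₁ : ContinuousOn (fun x : ℝ => t⁻¹ * x) (spectrum ℝ a) :=
    continuousOn_const.mul continuousOn_id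
  have h₂ : ContinuousOn (fun x : ℝ => t * (t + x)⁻¹) (spectrum ℝ a) :=
    continuousOn_const.mul hcont
  have h₃ : ContinuousOn (fun x : ℝ => t⁻¹ * x + t * (t + x)⁻¹) (spectrum ℝ a) := h₁.add h₂
  have h₄ : ContinuousOn (fun x : ℝ => t⁻¹ * x + t * (t + x)⁻¹ - 1) (spectrum ℝ a) :=
    h₃.sub continuousOn_const
  rw [cfc_const_mul _ _ a h₄,
    cfc_sub (fun x : ℝ => t⁻¹ * x + t * (t + x)⁻¹) (fun _ => 1) a h₃ continuousOn_const,
    cfc_add a (fun x : ℝ => t⁻¹ * x) (fun x : ℝ => t * (t + x)⁻¹) h₁ h₂,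
    cfc_const_mul _ (fun x : ℝ => x) a continuousOn_id, cfc_const_mul _ _ a hcont, cfc_inv_const_add ha ht,
    cfc_id' ℝ a ha.isSelfAdjoint, cfc_const_one ℝ a ha.isSelfAdjoint]

lemma sum_star_conjugate_cfcₙ_rpowIntegrand₀₁_le (hK : ∑ i, star (K i) * K i = 1)
    (hX : ∀ i, 0 ≤ X i) {p t : ℝ} (hp : p ∈ Ioo 0 1) (ht : 0 < t) :
    ∑ i, star (K i) * cfcₙ (Real.rpowIntegrand₀₁ p t) (X i) * K i ≤
      cfcₙ (Real.rpowIntegrand₀₁ p t) (∑ i, star (K i) * X i * K i) := by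
  rw [cfcₙ_rpowIntegrand₀₁_eq (sum_star_conjugate_nonneg hX) hp ht]
  simp_rw [cfcₙ_rpowIntegrand₀₁_eq (hX _) hp ht, mul_sub, sub_mul, Finset.sum_sub_distrib,
    sum_star_conjugate_algebraMap hK, mul_smul_comm, smul_mul_assoc, ← Finset.smul_sum]
  exact sub_le_sub_left (smul_le_smul_of_nonneg_left
    (ringInverse_algebraMap_add_sum_star_conjugate_le hK hX ht) (by positivity)) _

lemma cfcₙ_rpowIntegrand₁₂_sum_star_conjugate_le (hK : ∑ i, star (K i) * K i = 1)
    (hX : ∀ i, 0 ≤ X i) {p t : ℝ} (hp : p ∈ Ioo 1 2) (ht : 0 < t) :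
    cfcₙ (Real.rpowIntegrand₁₂ p t) (∑ i, star (K i) * X i * K i) ≤
      ∑ i, star (K i) * cfcₙ (Real.rpowIntegrand₁₂ p t) (X i) * K i := by
  rw [cfcₙ_rpowIntegrand₁₂_eq (sum_star_conjugate_nonneg hX) hp ht]
  simp_rw [cfcₙ_rpowIntegrand₁₂_eq (hX _) hp ht, mul_smul_comm, smul_mul_assoc,
    ← Finset.smul_sum, mul_sub, sub_mul, mul_add, add_mul, mul_one, Finset.sum_sub_distrib,
    Finset.sum_add_distrib, hK, mul_smul_comm, smul_mul_assoc, ← Finset.smul_sum]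
  refine smul_le_smul_of_nonneg_left (sub_le_sub_right (add_le_add_right ?_ _) _) (by positivity)
  exact smul_le_smul_of_nonneg_left
    (ringInverse_algebraMap_add_sum_star_conjugate_le hK hX ht) ht.le

section Integral

variable {α : Type*} [MeasurableSpace α] {μ : Measure α} {G : ι → α → A}

omit [PartialOrder A] [StarOrderedRing A] in
lemma integrable_sum_star_conjugate (hG : ∀ i, Integrable (G i) μ) :
    Integrable (fun t => ∑ i, star (K i) * G i t * K i) μ :=
  integrable_finsetSum _ fun i _ => ((hG i).const_mul (star (K i))).mul_const (K i)

omit [PartialOrder A] [StarOrderedRing A] in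
lemma integral_sum_star_conjugate (hG : ∀ i, Integrable (G i) μ) :
    ∫ t, ∑ i, star (K i) * G i t * K i ∂μ = ∑ i, star (K i) * (∫ t, G i t ∂μ) * K i := by
  rw [integral_finsetSum _ fun i _ => ((hG i).const_mul (star (K i))).mul_const (K i)]
  refine Finset.sum_congr rfl fun i _ => ?_
  exact (ContinuousLinearMap.mulLeftRight ℝ A (star (K i)) (K i)).integral_comp_comm (hG i)

end Integral

/-- The operator Jensen inequality for the concave powers. -/
lemma sum_star_conjugate_rpow_le (hK : ∑ i, star (K i) * K i = 1) (hX : ∀ i, 0 ≤ X i)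
    {p : ℝ} (hp : p ∈ Icc (0 : ℝ) 1) :
    ∑ i, star (K i) * X i ^ p * K i ≤ (∑ i, star (K i) * X i * K i) ^ p := by
  have hM := sum_star_conjugate_nonneg (K := K) hX
  -- The integral representation needs `0 < p < 1`; at both endpoints Jensen is an equality.
  obtain rfl | h0 := hp.1.eq_or_lt
  · simp_rw [CFC.rpow_zero _ hM, CFC.rpow_zero _ (hX _), mul_one, hK, le_refl]
  obtain rfl | h1 := hp.2.eq_or_lt
  · simp_rw [CFC.rpow_one _ hM, CFC.rpow_one _ (hX _), le_refl]
  lift p to NNReal using hp.1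
  have hp' : p ∈ Ioo 0 1 := ⟨by exact_mod_cast h0, by exact_mod_cast h1⟩
  simp_rw [← CFC.nnrpow_eq_rpow hp'.1]
  obtain ⟨μ, hμ⟩ := CFC.exists_measure_nnrpow_eq_integral_cfcₙ_rpowIntegrand₀₁ A hp'
  rw [(hμ _ hM).2]
  simp_rw [(hμ _ (hX _)).2]
  rw [← integral_sum_star_conjugate fun i => (hμ _ (hX i)).1]
  refine integral_mono_ae (integrable_sum_star_conjugate fun i => (hμ _ (hX i)).1) (hμ _ hM).1 ?_
  filter_upwards [ae_restrict_mem measurableSet_Ioi] with t ht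
  exact sum_star_conjugate_cfcₙ_rpowIntegrand₀₁_le hK hX ⟨h0, h1⟩ ht

/-- The operator Jensen inequality for the square. -/
lemma sq_sum_star_conjugate_le (hK : ∑ i, star (K i) * K i = 1)
    (hX : ∀ i, IsSelfAdjoint (X i)) :
    (∑ i, star (K i) * X i * K i) ^ 2 ≤ ∑ i, star (K i) * X i ^ 2 * K i := by
  set M := ∑ i, star (K i) * X i * K i with hMdef
  have hMs : star M = M := by
    simp [hMdef, star_sum, (hX _).star_eq, mul_assoc]
  -- A variance: the summed squares are the second moment minus `M ^ 2`.
  have key : ∀ i, star (X i * K i - K i * M) * (X i * K i - K i * M) =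
      star (K i) * X i ^ 2 * K i - star (K i) * X i * K i * M - M * (star (K i) * X i * K i)
        + M * (star (K i) * K i) * M := by
    intro i
    simp only [star_sub, star_mul, hMs, (hX i).star_eq, sub_mul, mul_sub, mul_assoc, pow_two]
    abel
  have hsum : ∑ i, star (X i * K i - K i * M) * (X i * K i - K i * M) =
      ∑ i, star (K i) * X i ^ 2 * K i - M ^ 2 := by
    simp_rw [key, Finset.sum_add_distrib, Finset.sum_sub_distrib, ← Finset.sum_mul,
      ← Finset.mul_sum, hK, ← hMdef, pow_two, mul_one]
    abel
  rw [← sub_nonneg, ← hsum]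
  exact Finset.sum_nonneg fun i _ => star_mul_self_nonneg _

/-- The operator Jensen inequality for the powers with exponent in `[1, 2]`. -/
lemma rpow_sum_star_conjugate_le_of_mem_Icc_one_two (hK : ∑ i, star (K i) * K i = 1)
    (hX : ∀ i, 0 ≤ X i) {p : ℝ} (hp : p ∈ Icc (1 : ℝ) 2) :
    (∑ i, star (K i) * X i * K i) ^ p ≤ ∑ i, star (K i) * X i ^ p * K i := by
  have hM := sum_star_conjugate_nonneg (K := K) hX
  obtain rfl | h1 := hp.1.eq_or_lt
  · simp_rw [CFC.rpow_one _ hM, CFC.rpow_one _ (hX _), le_refl]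
  obtain rfl | h2 := hp.2.eq_or_lt
  · have h (a : A) (ha : 0 ≤ a) : a ^ (2 : ℝ) = a ^ 2 := by exact_mod_cast CFC.rpow_natCast a 2 ha
    have hX' : ∀ i, X i ^ (2 : ℝ) = X i ^ 2 := fun i => h _ (hX i)
    simp only [h _ hM, hX']
    exact sq_sum_star_conjugate_le hK fun i => (hX i).isSelfAdjoint
  lift p to NNReal using zero_le_one.trans hp.1
  have hp' : p ∈ Ioo 1 2 := ⟨by exact_mod_cast h1, by exact_mod_cast h2⟩
  simp_rw [← CFC.nnrpow_eq_rpow (zero_lt_one.trans hp'.1)]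
  obtain ⟨μ, hμ⟩ := CFC.exists_measure_nnrpow_eq_integral_cfcₙ_rpowIntegrand₁₂ A hp'
  rw [(hμ _ hM).2]
  simp_rw [(hμ _ (hX _)).2]
  rw [← integral_sum_star_conjugate fun i => (hμ _ (hX i)).1]
  refine integral_mono_ae (hμ _ hM).1 (integrable_sum_star_conjugate fun i => (hμ _ (hX i)).1) ?_
  filter_upwards [ae_restrict_mem measurableSet_Ioi] with t ht
  exact cfcₙ_rpowIntegrand₁₂_sum_star_conjugate_le hK hX ⟨h1, h2⟩ ht

/-- A common scalar lower bound of the finitely many `X i` survives the averaging. -/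
lemma isStrictlyPositive_sum_star_conjugate (hK : ∑ i, star (K i) * K i = 1)
    (hX : ∀ i, IsStrictlyPositive (X i)) :
    IsStrictlyPositive (∑ i, star (K i) * X i * K i) := by
  nontriviality A
  choose r hr hrX using fun i =>
    (CFC.exists_pos_algebraMap_le_iff (hX i).isSelfAdjoint).2 fun x hx => (hX i).spectrum_pos hx
  obtain ⟨s, hs, hsr⟩ : ∃ s : ℝ, 0 < s ∧ ∀ i, s ≤ r i := by
    cases isEmpty_or_nonempty ι
    · exact ⟨1, one_pos, isEmptyElim⟩
    · obtain ⟨j, hj⟩ := Finite.exists_min r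
      exact ⟨r j, hr j, hj⟩
  refine (isStrictlyPositive_algebraMap (A := A) hs).of_le ?_
  rw [← sum_star_conjugate_algebraMap hK s]
  refine Finset.sum_le_sum fun i _ => star_left_conjugate_le_conjugate ?_ _
  refine le_trans ?_ (hrX i)
  simp_rw [Algebra.algebraMap_eq_smul_one]
  exact smul_le_smul_of_nonneg_right (hsr i) zero_le_one

/-- The operator Jensen inequality for the powers with exponent in `[-1, 0]`. -/
lemma rpow_sum_star_conjugate_le_of_mem_Icc_neg_one_zero (hK : ∑ i, star (K i) * K i = 1)
    (hX : ∀ i, IsStrictlyPositive (X i)) {p : ℝ} (hp : p ∈ Icc (-1 : ℝ) 0) :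
    (∑ i, star (K i) * X i * K i) ^ p ≤ ∑ i, star (K i) * X i ^ p * K i := by
  have hM := isStrictlyPositive_sum_star_conjugate hK hX
  obtain rfl | h0 := hp.2.eq_or_lt
  · simp_rw [CFC.rpow_zero _ hM.nonneg, CFC.rpow_zero _ (hX _).nonneg, mul_one, hK, le_refl]
  have hinv : ∀ a : A, IsStrictlyPositive a → a ^ p = Ring.inverse (a ^ (-p)) := fun a ha => by
    rw [CFC.inverse_rpow a _ (neg_ne_zero.2 h0.ne) ha, neg_neg]
  have hXp : ∀ i, IsStrictlyPositive (X i ^ (-p)) := fun i => (hX i).rpow _ _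
  have hMp := isStrictlyPositive_sum_star_conjugate hK hXp
  rw [hinv _ hM]
  simp_rw [hinv _ (hX _)]
  -- Since `-p ∈ (0,1]`, inverting the concave inequality bounds the left side by the inverse of `∑
  -- K* X^(-p) K`; Jensen for the inverse finishes.
  exact (CStarAlgebra.ringInverse_le_ringInverse (sum_star_conjugate_rpow_le hK
    (fun i => (hX i).nonneg) ⟨by linarith [hp.2], by linarith [hp.1]⟩) hMp).trans
    (ringInverse_sum_star_conjugate_le hK hXp hMp)

lemma tendsto_inv_smul_rpow_sub_one_log {a : A} (ha : IsStrictlyPositive a) :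
    Tendsto (fun p : ℝ => p⁻¹ • (a ^ p - 1)) (𝓝[>] 0) (𝓝 (CFC.log a)) := by
  refine (CFC.tendsto_cfc_rpow_sub_one_log ha).congr fun p => ?_
  have hcont : ContinuousOn (fun x : ℝ => x ^ p) (spectrum ℝ a) := fun x hx =>
    (Real.continuousAt_rpow_const x p (.inl (ha.spectrum_pos hx).ne')).continuousWithinAt
  rw [cfc_const_mul .., cfc_sub (fun x : ℝ => x ^ p) (fun _ => 1) a, cfc_const_one ..,
    CFC.rpow_eq_cfc_real ha.nonneg]

/-- The operator Jensen inequality for the logarithm. -/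
lemma sum_star_conjugate_log_le (hK : ∑ i, star (K i) * K i = 1)
    (hX : ∀ i, IsStrictlyPositive (X i)) :
    ∑ i, star (K i) * CFC.log (X i) * K i ≤ CFC.log (∑ i, star (K i) * X i * K i) := by
  have hM := isStrictlyPositive_sum_star_conjugate hK hX
  refine le_of_tendsto_of_tendsto (tendsto_finsetSum _ fun i _ =>
    ((tendsto_inv_smul_rpow_sub_one_log (hX i)).const_mul (star (K i))).mul_const (K i))
    (tendsto_inv_smul_rpow_sub_one_log hM) ?_
  filter_upwards [Ioo_mem_nhdsGT (zero_lt_one (α := ℝ))] with p hp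
  -- By `hK` the subtracted `1` is the same on both sides, leaving the concave power inequality
  -- scaled by `p⁻¹ > 0`.
  simp_rw [mul_smul_comm, smul_mul_assoc, ← Finset.smul_sum, mul_sub, sub_mul, mul_one,
    Finset.sum_sub_distrib, hK]
  exact smul_le_smul_of_nonneg_left (sub_le_sub_right (sum_star_conjugate_rpow_le hK
    (fun i => (hX i).nonneg) ⟨hp.1.le, hp.2.le⟩) _) (inv_nonneg.2 hp.1.le)

end OperatorJensen

/-! ### The operator `D` and the reduction to Jensen. -/

section Hua

variable {H : Type*} [NormedAddCommGroup H] [InnerProductSpace ℂ H] [CompleteSpace H]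
  {n : ℕ} (C : Fin n → (H →L[ℂ] H))

lemma isStrictlyPositive_one_add_sum_star_mul_self :
    IsStrictlyPositive (1 + ∑ i, star (C i) * C i) :=
  isStrictlyPositive_one.of_le
    (le_add_of_nonneg_right (Finset.sum_nonneg fun i _ => star_mul_self_nonneg (C i)))

lemma isStrictlyPositive_huaD : IsStrictlyPositive (huaD C) :=
  (isStrictlyPositive_one_add_sum_star_mul_self C).rpow _ _

lemma huaD_mul_mul_huaD : huaD C * (1 + ∑ i, star (C i) * C i) * huaD C = 1 := by
  have h := isStrictlyPositive_one_add_sum_star_mul_self C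
  unfold huaD
  set S := 1 + ∑ i, star (C i) * C i
  nth_rewrite 2 [← CFC.rpow_one S h.nonneg]
  rw [← CFC.rpow_add h.isUnit, ← CFC.rpow_add h.isUnit]
  norm_num [CFC.rpow_zero S h.nonneg]

variable {C}

/-- The family `D, C₁ D, …, Cₙ D`. -/
noncomputable def huaFamily (C : Fin n → (H →L[ℂ] H)) : Option (Fin n) → (H →L[ℂ] H) :=
  fun j => j.elim (huaD C) fun i => C i * huaD C

/-- Used three ways: `Y = 1` normalises the family, the given operators yield `DBD`, and their
images under `f` yield the other side of each inequality. -/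
lemma sum_huaFamily_conjugate (Y : Option (Fin n) → (H →L[ℂ] H)) :
    ∑ j, star (huaFamily C j) * Y j * huaFamily C j =
      huaD C * (Y none + ∑ i, star (C i) * Y (some i) * C i) * huaD C := by
  simp [huaFamily, Fintype.sum_option, (isStrictlyPositive_huaD C).isSelfAdjoint.star_eq,
    mul_add, add_mul, Finset.mul_sum, Finset.sum_mul, mul_assoc]

lemma sum_star_huaFamily_mul_self : ∑ j, star (huaFamily C j) * huaFamily C j = 1 := by
  simpa [huaD_mul_mul_huaD] using sum_huaFamily_conjugate (C := C) fun _ => 1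

lemma ringInverse_huaD_conjugate (Z : H →L[ℂ] H) :
    Ring.inverse (huaD C) * (huaD C * Z * huaD C) * Ring.inverse (huaD C) = Z := by
  have hD := (isStrictlyPositive_huaD C).isUnit
  rw [mul_assoc (huaD C), ← mul_assoc, Ring.inverse_mul_cancel _ hD, one_mul, mul_assoc,
    Ring.mul_inverse_cancel _ hD, mul_one]

lemma ringInverse_huaD_conjugate_mono {S T : H →L[ℂ] H} (h : S ≤ T) :
    Ring.inverse (huaD C) * S * Ring.inverse (huaD C) ≤
      Ring.inverse (huaD C) * T * Ring.inverse (huaD C) :=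
  (isStrictlyPositive_huaD C).isSelfAdjoint.ringInverse.conjugate_le_conjugate h

end Hua

theorem mainTheorem7 {H : Type*} [NormedAddCommGroup H] [InnerProductSpace ℂ H]
    [CompleteSpace H] (n : ℕ) (B : H →L[ℂ] H) (A C : Fin n → (H →L[ℂ] H))
    (hB : IsSelfAdjoint B) (hA : ∀ i, IsSelfAdjoint (A i))
    (hBpos : IsStrictlyPositive (B - ∑ i, star (C i) * A i * C i))
    (hApos : ∀ i, IsStrictlyPositive (A i)) :
    -- the operators whose inverse, power or logarithm occurs on the right are strictly positive
    IsStrictlyPositive (huaD C) ∧ IsStrictlyPositive (huaD C * B * huaD C) ∧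
    -- (i)
    (Ring.inverse (huaD C) * Ring.inverse (huaD C * B * huaD C) * Ring.inverse (huaD C) ≤
      Ring.inverse (B - ∑ i, star (C i) * A i * C i) +
        ∑ i, star (C i) * Ring.inverse (A i) * C i) ∧
    -- (ii)
    (∀ p : ℝ, p ∈ Set.Icc (-1 : ℝ) 0 ∪ Set.Icc (1 : ℝ) 2 →
      Ring.inverse (huaD C) * (huaD C * B * huaD C) ^ p * Ring.inverse (huaD C) ≤
        (B - ∑ i, star (C i) * A i * C i) ^ p + ∑ i, star (C i) * (A i) ^ p * C i) ∧
    -- (iii)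
    (∀ p : ℝ, p ∈ Set.Icc (0 : ℝ) 1 →
      (B - ∑ i, star (C i) * A i * C i) ^ p + ∑ i, star (C i) * (A i) ^ p * C i ≤
        Ring.inverse (huaD C) * (huaD C * B * huaD C) ^ p * Ring.inverse (huaD C)) ∧
    -- (iv)
    (CFC.log (B - ∑ i, star (C i) * A i * C i) + ∑ i, star (C i) * CFC.log (A i) * C i ≤
      Ring.inverse (huaD C) * CFC.log (huaD C * B * huaD C) * Ring.inverse (huaD C)) := by
  have hD := isStrictlyPositive_huaD C
  set Y : Option (Fin n) → (H →L[ℂ] H) :=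
    fun j => j.elim (B - ∑ i, star (C i) * A i * C i) A with hYdef
  have hY : ∀ j, IsStrictlyPositive (Y j) := by
    rintro (_ | i)
    exacts [hBpos, hApos i]
  have hK := sum_star_huaFamily_mul_self (C := C)
  have hsum : ∑ j, star (huaFamily C j) * Y j * huaFamily C j = huaD C * B * huaD C := by
    rw [sum_huaFamily_conjugate]
    simp [hYdef]
  -- Purely algebraic in `f`, so it serves the inverse, the powers and the logarithm alike.
  have hfun : ∀ f : (H →L[ℂ] H) → (H →L[ℂ] H),
      Ring.inverse (huaD C) * (∑ j, star (huaFamily C j) * f (Y j) * huaFamily C j) *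
        Ring.inverse (huaD C) =
      f (B - ∑ i, star (C i) * A i * C i) + ∑ i, star (C i) * f (A i) * C i := by
    intro f
    rw [sum_huaFamily_conjugate fun j => f (Y j), ringInverse_huaD_conjugate]
    rfl
  have hM := isStrictlyPositive_sum_star_conjugate hK hY
  refine ⟨hD, hsum ▸ hM, ?_, fun p hp => ?_, fun p hp => ?_, ?_⟩
  · rw [← hfun Ring.inverse, ← hsum]
    exact ringInverse_huaD_conjugate_mono (ringInverse_sum_star_conjugate_le hK hY hM)
  · rw [← hfun (· ^ p), ← hsum]
    refine ringInverse_huaD_conjugate_mono ?_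
    rcases hp with hp | hp
    · exact rpow_sum_star_conjugate_le_of_mem_Icc_neg_one_zero hK hY hp
    · exact rpow_sum_star_conjugate_le_of_mem_Icc_one_two hK (fun j => (hY j).nonneg) hp
  · rw [← hfun (· ^ p), ← hsum]
    exact ringInverse_huaD_conjugate_mono
      (sum_star_conjugate_rpow_le hK (fun j => (hY j).nonneg) hp)
  · rw [← hfun CFC.log, ← hsum]
    exact ringInverse_huaD_conjugate_mono (sum_star_conjugate_log_le hK hY)
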